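/- \textbf{Proposition (interval-based reachability).} Let $n,p\ge 0$ be integers and let $f:\mathbb{R}^n\times\mathbb{R}^p\times\mathbb{Z}_{\ge 0}\to\mathbb{R}^n$. Assume that for every $t\ge 0$ there is $L_t\ge 0$ with $\|f(x,u,t)-f(y,u,t)\|\le L_t\|x-y\|$ for all $x,y\in\mathbb{R}^n$ and $u\in\mathbb{R}^p$ ($\|\cdot\|$ is the Euclidean norm). Let $w_0,w_1,\dots$ be independent random vectors in $\mathbb{R}^n$ such that, for every $t$ and some $\sigma_t\ge 0$, $w_t$ is sub-Gaussian with variance proxy $\sigma_t^2$, i.e. $\mathbb{E}(w_t)=0$ and $\mathbb{E}\,e^{\lambda\langle \ell,w_t\rangle}\le e^{\lambda^2\sigma_t^2/2}$ for all $\lambda\in\mathbb{R}$ and all unit vectors $\ell\in\mathbb{R}^n$. Inequalities between vectors are componentwise and $[a,b]=\{x: a\le x\le b\}$. Let $\mathsf F=(\underline{\mathsf F},\overline{\mathsf F}):\mathbb{R}^{2n}\times\mathbb{R}^{2p}\times\mathbb{Z}_{\ge 0}\to\mathbb{R}^{2n}$ be an inclusion function for $f$: for all $a,b\in\mathbb{R}^n$,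 $c,d\in\mathbb{R}^p$, $z\in[a,b]$, $v\in[c,d]$ and $t\in\mathbb{Z}_{\ge 0}$, $$\underline{\mathsf F}(a,b,c,d,t)\le f(z,v,t)\le\overline{\mathsf F}(a,b,c,d,t).$$ Let $\underline{x}_0,\overline{x}_0\in\mathbb{R}^n$ and $\underline{u},\overline{u}\in\mathbb{R}^p$, and let $(\underline{x}_t,\overline{x}_t)_{t\ge 0}$ be the trajectory, starting from $(\underline{x}_0,\overline{x}_0)$, of the embedding system $$\underline{x}_{t+1}=\underline{\mathsf F}(\underline{x}_t,\overline{x}_t,\underline{u},\overline{u},t),\qquad \overline{x}_{t+1}=\overline{\mathsf F}(\underline{x}_t,\overline{x}_t,\underline{u},\overline{u},t).$$ Let $x_0\in[\underline{x}_0,\overline{x}_0]$, let $u_t\in[\underline{u},\overline{u}]$ for every $t\ge 0$ be a deterministic input sequence, and let $X_0=x_0$, $X_{t+1}=f(X_t,u_t,t)+w_t$. Then for every $t\in\mathbb{Z}_{\ge 0}$, $\delta\in(0,1]$ and $\varepsilon\in(0,1)$, with probability at least $1-\delta$, $$X_t\in[\underline{x}_t,\overline{x}_t]\oplus\{y\in\mathbb{R}^n:\|y\|\le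 r_{\delta,t}\},$$ where $\oplus$ is the Minkowski sum and $$r_{\delta,t}=\sqrt{\Psi_t\,(\varepsilon_1 n+\varepsilon_2\log(1/\delta))},\qquad \varepsilon_1=\frac{2\log(1+2/\varepsilon)}{(1-\varepsilon)^2},\qquad \varepsilon_2=\frac{2}{(1-\varepsilon)^2},\qquad \Psi_t=\sum_{k=0}^{t-1}\sigma_k^2\prod_{j=k+1}^{t-1}L_j^2 .$$ When all $L_k>0$, $\Psi_t=\psi_{t-1}\sum_{k=0}^{t-1}\sigma_k^2\psi_k^{-1}$ with $\psi_t=\prod_{k=0}^{t}L_k^2$. -/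

import Mathlib

open MeasureTheory ProbabilityTheory
open scoped Pointwise

namespace StochReach

/-- Euclidean space `ℝⁿ` (with the `l₂` norm). -/
abbrev Vec (n : ℕ) : Type := EuclideanSpace ℝ (Fin n)

/-- The interval (box) `[a, b] ⊆ ℝⁿ` for the componentwise order. -/
def box {n : ℕ} (a b : Vec n) : Set (Vec n) :=
  {x | ∀ i, a i ≤ x i ∧ x i ≤ b i}

/-- At every time `t` the map `x ↦ f(x, u, t)` is Lipschitz with constant `L t ≥ 0`,
uniformly in the input `u`. -/
def LipschitzDynamics {n p : ℕ} (f : Vec n → Vec p → ℕ → Vec n) (L : ℕ → ℝ) : Prop :=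
  ∀ t, 0 ≤ L t ∧ ∀ (x y : Vec n) (u : Vec p), ‖f x u t - f y u t‖ ≤ L t * ‖x - y‖

/-- The random vector `X` is sub-Gaussian with variance proxy `s` (that is, `σ²`): it has mean
zero, and `E exp(c ⟪ℓ, X⟫) ≤ exp(c² s / 2)` for every real `c` and unit vector `ℓ`. -/
structure IsSubGaussian {Ω : Type*} [MeasurableSpace Ω] {n : ℕ}
    (X : Ω → Vec n) (s : ℝ) (μ : Measure Ω) : Prop where
  integrable : Integrable X μ
  mean_zero : ∫ ω, X ω ∂μ = 0
  integrable_exp : ∀ (c : ℝ) (ℓ : Vec n), ‖ℓ‖ = 1 →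
    Integrable (fun ω => Real.exp (c * inner ℝ ℓ (X ω))) μ
  mgf_le : ∀ (c : ℝ) (ℓ : Vec n), ‖ℓ‖ = 1 →
    ∫ ω, Real.exp (c * inner ℝ ℓ (X ω)) ∂μ ≤ Real.exp (c ^ 2 * s / 2)

/-- `X` is the trajectory of `X_{t+1} = f(X_t, u_t, t) + w_t` with initial state `x₀`,
input `u` and disturbance `w`. -/
def IsStochasticTrajectory {Ω : Type*} {n p : ℕ} (f : Vec n → Vec p → ℕ → Vec n)
    (x₀ : Vec n) (u : ℕ → Vec p) (w : ℕ → Ω → Vec n) (X : ℕ → Ω → Vec n) : Prop :=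
  (∀ ω, X 0 ω = x₀) ∧ ∀ t ω, X (t + 1) ω = f (X t ω) (u t) t + w t ω

/-- `F = (F̲, F̄) : ℝ²ⁿ × ℝ²ᵖ × ℕ → ℝ²ⁿ` is an inclusion function for `f`:
for all intervals `[a, b] ⊆ ℝⁿ` and `[c, d] ⊆ ℝᵖ`, all `(z, v)` in `[a, b] × [c, d]` and all
`t`, `F̲(a, b, c, d, t) ≤ f(z, v, t) ≤ F̄(a, b, c, d, t)` componentwise. -/
def IsInclusionFunction {n p : ℕ} (f : Vec n → Vec p → ℕ → Vec n)
    (F : Vec n × Vec n → Vec p × Vec p → ℕ → Vec n × Vec n) : Prop :=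
  ∀ (a b : Vec n) (c d : Vec p) (t : ℕ), ∀ z ∈ box a b, ∀ v ∈ box c d,
    ∀ i, (F (a, b) (c, d) t).1 i ≤ f z v t i ∧ f z v t i ≤ (F (a, b) (c, d) t).2 i

/-- The pair `(x̲, x̄) : ℕ → ℝⁿ × ℝⁿ` is the trajectory of the embedding system
`(x̲_{t+1}, x̄_{t+1}) = F(x̲_t, x̄_t, c, d, t)` associated with `F` and the input interval
`[c, d]`, starting from `(a, b)`. -/
def IsEmbeddingTrajectory {n p : ℕ}
    (F : Vec n × Vec n → Vec p × Vec p → ℕ → Vec n × Vec n)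
    (a b : Vec n) (c d : Vec p) (xe : ℕ → Vec n × Vec n) : Prop :=
  xe 0 = (a, b) ∧ ∀ t, xe (t + 1) = F (xe t) (c, d) t

/-- `ψ_t = ∏_{k=0}^{t} L_k²`. -/
noncomputable def psi (L : ℕ → ℝ) (t : ℕ) : ℝ :=
  ∏ k ∈ Finset.range (t + 1), L k ^ 2

/-- `Ψ_t = ∑_{k=0}^{t-1} σ_k² ∏_{j=k+1}^{t-1} L_j²`. This is
`ψ_{t-1} ∑_{k=0}^{t-1} σ_k² ψ_k⁻¹` with the common factors of `ψ_{t-1}` and `ψ_k` cancelled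
(see `Psi_eq`), so that it also makes sense when some `L_k` vanish. -/
noncomputable def Psi (L σ : ℕ → ℝ) (t : ℕ) : ℝ :=
  ∑ k ∈ Finset.range t, σ k ^ 2 * ∏ j ∈ Finset.Ico (k + 1) t, L j ^ 2

theorem Psi_eq (L σ : ℕ → ℝ) (hL : ∀ k, L k ≠ 0) (t : ℕ) :
    Psi L σ t = psi L (t - 1) * ∑ k ∈ Finset.range t, σ k ^ 2 * (psi L k)⁻¹ := by
  unfold Psi
  rw [Finset.mul_sum]
  refine Finset.sum_congr rfl fun k hk => ?_
  have hkt : k + 1 ≤ t := Finset.mem_range.mp hk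
  have ht : t - 1 + 1 = t := by omega
  have hne : psi L k ≠ 0 := Finset.prod_ne_zero_iff.mpr fun j _ => pow_ne_zero 2 (hL j)
  have h : psi L k * ∏ j ∈ Finset.Ico (k + 1) t, L j ^ 2 = psi L (t - 1) := by
    unfold psi
    rw [ht]
    exact Finset.prod_range_mul_prod_Ico _ hkt
  rw [← h]
  field_simp

/-- `ε₁ = 2 log(1 + 2/ε) / (1 - ε)²`. -/
noncomputable def eps1 (ε : ℝ) : ℝ := 2 * Real.log (1 + 2 / ε) / (1 - ε) ^ 2

/-- `ε₂ = 2 / (1 - ε)²`. -/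
noncomputable def eps2 (ε : ℝ) : ℝ := 2 / (1 - ε) ^ 2

/-- `r_{δ,t} = √(Ψ_t (ε₁ n + ε₂ log(1/δ)))`. -/
noncomputable def radius (n : ℕ) (L σ : ℕ → ℝ) (ε δ : ℝ) (t : ℕ) : ℝ :=
  Real.sqrt (Psi L σ t * (eps1 ε * n + eps2 ε * Real.log (1 / δ)))

end StochReach

/-! Compare `X t` with the noise-free trajectory `nominal`, which the inclusion function keeps
inside the embedding box; it remains to bound the norm of the deviation. A fixed direction ℓ does
not survive a nonlinear Lipschitz map, so the exponentials exp⟪ℓ, v⟫ are averaged over the unit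
ball. The average `ballMGF` is rotation invariant and increasing in ‖v‖, so a map with constant L
costs only the replacement of c by c L. Independent noise costs a factor exp(c²σ²/2), and these two
costs accumulate to exp(c²Ψ_t/2). Conversely `le_ballMGF` bounds `ballMGF` below by (ε/2)ⁿ
exp((1-ε)‖v‖) times the ball's volume, so Markov's inequality and a choice of c give the tail bound.
-/

namespace StochReach

open scoped ENNReal

/-! ### Exponentials averaged over the unit ball -/

section BallMGF

variable {E : Type*} [NormedAddCommGroup E] [InnerProductSpace ℝ E] [FiniteDimensional ℝ E]
  [MeasurableSpace E] [BorelSpace E]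

/-- The (unnormalised) moment generating function `v ↦ ∫ exp ⟪ℓ, v⟫ dℓ` of the uniform
distribution on the unit ball. -/
noncomputable def ballMGF (v : E) : ℝ≥0∞ :=
  ∫⁻ ℓ in Metric.closedBall (0 : E) 1, ENNReal.ofReal (Real.exp (inner ℝ ℓ v))

theorem measurable_ballMGF : Measurable (ballMGF : E → ℝ≥0∞) := by
  unfold ballMGF
  apply Measurable.lintegral_prod_right
  fun_prop

theorem ballMGF_map (e : E ≃ₗᵢ[ℝ] E) (v : E) : ballMGF (e v) = ballMGF v := by
  have hpre : e ⁻¹' Metric.closedBall (0 : E) 1 = Metric.closedBall 0 1 := by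
    ext x
    simp
  have h := e.measurePreserving.setLIntegral_comp_preimage
    (Metric.isClosed_closedBall (x := (0 : E)) (ε := 1)).measurableSet
    (f := fun ℓ => ENNReal.ofReal (Real.exp (inner ℝ ℓ (e v)))) (by fun_prop)
  rw [hpre] at h
  unfold ballMGF
  rw [← h]
  simp only [LinearIsometryEquiv.inner_map_map]

/-- Two vectors of equal norm are exchanged by the reflection in the hyperplane orthogonal to their
difference. -/
theorem ballMGF_eq_of_norm_eq {v v' : E} (h : ‖v‖ = ‖v'‖) : ballMGF v = ballMGF v' := by
  rw [← Submodule.reflection_sub h, ballMGF_map]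

theorem exp_mul_le (s x : ℝ) (h₀ : 0 ≤ s) (h₁ : s ≤ 1) :
    Real.exp (s * x) ≤ (1 + s) / 2 * Real.exp x + (1 - s) / 2 * Real.exp (-x) := by
  have h := convexOn_exp.2 (Set.mem_univ x) (Set.mem_univ (-x))
    (by linarith : 0 ≤ (1 + s) / 2) (by linarith : 0 ≤ (1 - s) / 2) (by ring)
  simp only [smul_eq_mul] at h
  rwa [show (1 + s) / 2 * x + (1 - s) / 2 * -x = s * x by ring] at h

/-- Convexity and evenness: s • v is a convex combination of v and -v, at which `ballMGF` takes the
same value. -/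
theorem ballMGF_smul_le (s : ℝ) (h₀ : 0 ≤ s) (h₁ : s ≤ 1) (v : E) :
    ballMGF (s • v) ≤ ballMGF v := by
  have hp : 0 ≤ (1 + s) / 2 := by linarith
  have hm : 0 ≤ (1 - s) / 2 := by linarith
  calc ballMGF (s • v)
      ≤ ∫⁻ ℓ in Metric.closedBall (0 : E) 1,
          (ENNReal.ofReal ((1 + s) / 2) * ENNReal.ofReal (Real.exp (inner ℝ ℓ v)) +
            ENNReal.ofReal ((1 - s) / 2) * ENNReal.ofReal (Real.exp (inner ℝ ℓ (-v)))) := by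
        refine lintegral_mono fun ℓ => ?_
        rw [← ENNReal.ofReal_mul hp, ← ENNReal.ofReal_mul hm,
          ← ENNReal.ofReal_add (by positivity) (by positivity), inner_smul_right, inner_neg_right]
        exact ENNReal.ofReal_le_ofReal (exp_mul_le s _ h₀ h₁)
    _ = ENNReal.ofReal ((1 + s) / 2) * ballMGF v +
          ENNReal.ofReal ((1 - s) / 2) * ballMGF (-v) := by
        rw [lintegral_add_left (by fun_prop), lintegral_const_mul _ (by fun_prop),
          lintegral_const_mul _ (by fun_prop)]
        rfl
    _ = ballMGF v := by
        rw [ballMGF_eq_of_norm_eq (norm_neg v), ← add_mul, ← ENNReal.ofReal_add hp hm,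
          show (1 + s) / 2 + (1 - s) / 2 = 1 by ring, ENNReal.ofReal_one, one_mul]

theorem ballMGF_mono {v v' : E} (h : ‖v‖ ≤ ‖v'‖) : ballMGF v ≤ ballMGF v' := by
  rcases eq_or_ne v 0 with rfl | hv
  · simpa using ballMGF_smul_le 0 le_rfl zero_le_one v'
  have hpos : 0 < ‖v‖ := norm_pos_iff.mpr hv
  have hpos' : 0 < ‖v'‖ := hpos.trans_le h
  have hnorm : ‖(‖v'‖ / ‖v‖) • v‖ = ‖v'‖ := by
    rw [norm_smul, norm_div, norm_norm, norm_norm]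
    field_simp
  have hle := ballMGF_smul_le (‖v‖ / ‖v'‖) (by positivity) ((div_le_one hpos').mpr h)
    ((‖v'‖ / ‖v‖) • v)
  rw [ballMGF_eq_of_norm_eq hnorm, smul_smul] at hle
  convert hle
  rw [div_mul_div_cancel₀ hpos'.ne', div_self hpos.ne', one_smul]

theorem ballMGF_zero : ballMGF (0 : E) = volume (Metric.closedBall (0 : E) 1) := by
  simp [ballMGF]

/-- The cap `{ℓ | (1 - ε) ‖v‖ ≤ ⟪ℓ, v⟫}` of the unit ball contains a ball of radius `ε / 2`. -/
theorem le_ballMGF {ε : ℝ} (hε₀ : 0 < ε) (hε₁ : ε < 1) (v : E) :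
    ENNReal.ofReal ((ε / 2) ^ Module.finrank ℝ E * Real.exp ((1 - ε) * ‖v‖)) *
      volume (Metric.closedBall (0 : E) 1) ≤ ballMGF v := by
  -- The ball of radius ε/2 about this centre touches the unit sphere in the direction of v. For v =
  -- 0 the centre is 0, as 0⁻¹ = 0.
  set c : E := ((1 - ε / 2) * ‖v‖⁻¹) • v with hc
  have hcnorm : ‖c‖ ≤ 1 - ε / 2 := by
    rw [hc, norm_smul, norm_mul, norm_inv, norm_norm, Real.norm_of_nonneg (by linarith), mul_assoc]
    exact mul_le_of_le_one_right (by linarith) (inv_mul_le_one)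
  have hcinner : inner ℝ c v = (1 - ε / 2) * ‖v‖ := by
    rw [hc, real_inner_smul_left, real_inner_self_eq_norm_sq]
    rcases eq_or_ne ‖v‖ 0 with h | h
    · simp [h]
    · field_simp
  have hsub : Metric.closedBall c (ε / 2) ⊆ Metric.closedBall (0 : E) 1 := by
    apply Metric.closedBall_subset_closedBall'
    rw [dist_zero_right]
    linarith
  calc _ = ∫⁻ _ in Metric.closedBall c (ε / 2), ENNReal.ofReal (Real.exp ((1 - ε) * ‖v‖)) := by
        rw [setLIntegral_const, Measure.addHaar_closedBall' _ _ (by linarith : 0 ≤ ε / 2),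
          ENNReal.ofReal_mul (by positivity)]
        ring
    _ ≤ ∫⁻ ℓ in Metric.closedBall c (ε / 2), ENNReal.ofReal (Real.exp (inner ℝ ℓ v)) := by
        refine setLIntegral_mono' Metric.isClosed_closedBall.measurableSet fun ℓ hℓ => ?_
        refine ENNReal.ofReal_le_ofReal (Real.exp_le_exp.mpr ?_)
        have h₁ : ‖ℓ - c‖ ≤ ε / 2 := by rwa [← dist_eq_norm]
        have h₂ := neg_le_of_abs_le (abs_real_inner_le_norm (ℓ - c) v)
        have h₃ := mul_le_mul_of_nonneg_right h₁ (norm_nonneg v)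
        rw [inner_sub_left, hcinner] at h₂
        linarith
    _ ≤ ballMGF v := lintegral_mono_set hsub

end BallMGF

/-! ### Sub-Gaussian noise and the tail bound -/

section Concentration

variable {Ω : Type*} [MeasurableSpace Ω] {μ : Measure Ω} {n : ℕ}

/-- Normalising ℓ turns c into c‖ℓ‖, which only lowers the exponent c²s/2. -/
theorem IsSubGaussian.lintegral_exp_le [IsProbabilityMeasure μ] {W : Ω → Vec n} {s : ℝ}
    (hs : 0 ≤ s) (hW : IsSubGaussian W s μ) (c : ℝ) {ℓ : Vec n} (hℓ : ‖ℓ‖ ≤ 1) :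
    ∫⁻ ω, ENNReal.ofReal (Real.exp (inner ℝ ℓ (c • W ω))) ∂μ ≤
      ENNReal.ofReal (Real.exp (c ^ 2 * s / 2)) := by
  rcases eq_or_ne ℓ 0 with rfl | h0
  · simp only [inner_zero_left, Real.exp_zero, ENNReal.ofReal_one, lintegral_const, measure_univ,
      mul_one]
    rw [← ENNReal.ofReal_one]
    exact ENNReal.ofReal_le_ofReal (Real.one_le_exp (by positivity))
  have hpos : ‖ℓ‖ ≠ 0 := norm_ne_zero_iff.mpr h0
  have hunit : ‖‖ℓ‖⁻¹ • ℓ‖ = 1 := by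
    rw [norm_smul, norm_inv, norm_norm, inv_mul_cancel₀ hpos]
  have heq : ∀ ω, inner ℝ ℓ (c • W ω) = (c * ‖ℓ‖) * inner ℝ (‖ℓ‖⁻¹ • ℓ) (W ω) := fun ω => by
    rw [real_inner_smul_left, real_inner_smul_right]
    field_simp
  simp_rw [heq]
  rw [← ofReal_integral_eq_lintegral_ofReal (hW.integrable_exp _ _ hunit)
    (ae_of_all _ fun ω => (Real.exp_pos _).le)]
  refine ENNReal.ofReal_le_ofReal ((hW.mgf_le _ _ hunit).trans (Real.exp_le_exp.mpr ?_))
  have : ‖ℓ‖ ^ 2 ≤ 1 := pow_le_one₀ (norm_nonneg _) hℓ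
  rw [mul_pow]
  gcongr
  exact mul_le_of_le_one_right (sq_nonneg c) this

/-- Adding an independent sub-Gaussian vector. -/
theorem lintegral_ballMGF_add_le [IsProbabilityMeasure μ] {Y W : Ω → Vec n} {s : ℝ} (hs : 0 ≤ s)
    (hY : Measurable Y) (hWm : Measurable W) (hind : IndepFun Y W μ)
    (hW : IsSubGaussian W s μ) (c : ℝ) :
    ∫⁻ ω, ballMGF (c • (Y ω + W ω)) ∂μ ≤
      ENNReal.ofReal (Real.exp (c ^ 2 * s / 2)) * ∫⁻ ω, ballMGF (c • Y ω) ∂μ := by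
  unfold ballMGF
  -- After Tonelli, independence and the noise bound apply for each fixed ℓ.
  have hswap : ∀ Z : Ω → Vec n, Measurable Z →
      ∫⁻ ω, (∫⁻ ℓ in Metric.closedBall (0 : Vec n) 1,
        ENNReal.ofReal (Real.exp (inner ℝ ℓ (c • Z ω)))) ∂μ =
      ∫⁻ ℓ in Metric.closedBall (0 : Vec n) 1,
        (∫⁻ ω, ENNReal.ofReal (Real.exp (inner ℝ ℓ (c • Z ω))) ∂μ) :=
    fun Z hZ => lintegral_lintegral_swap
      (f := fun ω ℓ => ENNReal.ofReal (Real.exp (inner ℝ ℓ (c • Z ω)))) (by fun_prop)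
  rw [hswap (fun ω => Y ω + W ω) (hY.add hWm), hswap Y hY, ← lintegral_const_mul' _ _ ENNReal.ofReal_ne_top]
  refine setLIntegral_mono' (Metric.isClosed_closedBall (x := (0 : Vec n)) (ε := 1)).measurableSet
    fun ℓ hℓ => ?_
  have hmeas : Measurable fun x : Vec n => ENNReal.ofReal (Real.exp (inner ℝ ℓ (c • x))) := by
    fun_prop
  have hmul := lintegral_mul_eq_lintegral_mul_lintegral_of_indepFun
    (hmeas.comp hY) (hmeas.comp hWm) (hind.comp hmeas hmeas)
  simp only [Pi.mul_apply, Function.comp_apply] at hmul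
  simp_rw [smul_add, inner_add_right, Real.exp_add, ENNReal.ofReal_mul (Real.exp_nonneg _)]
  rw [hmul, mul_comm]
  gcongr
  exact hW.lintegral_exp_le hs c (by simpa using hℓ)

/-- Chernoff bound for the norm. -/
theorem measure_norm_ge_le {D : Ω → Vec n} (hD : Measurable D) {S c : ℝ} (hc : 0 ≤ c)
    (h : ∫⁻ ω, ballMGF (c • D ω) ∂μ ≤
      ENNReal.ofReal (Real.exp (c ^ 2 * S / 2)) * volume (Metric.closedBall (0 : Vec n) 1))
    {ε : ℝ} (hε₀ : 0 < ε) (hε₁ : ε < 1) (r : ℝ) :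
    μ {ω | r ≤ ‖D ω‖} ≤
      ENNReal.ofReal ((2 / ε) ^ n * Real.exp (c ^ 2 * S / 2 - (1 - ε) * (c * r))) := by
  set V := volume (Metric.closedBall (0 : Vec n) 1) with hV
  have hV0 : V ≠ 0 := (Metric.measure_closedBall_pos _ _ one_pos).ne'
  have hVtop : V ≠ ∞ := measure_closedBall_lt_top.ne
  set a : ℝ := (ε / 2) ^ n * Real.exp ((1 - ε) * (c * r)) with ha
  have ha0 : 0 < a := by positivity
  have hsub : {ω | r ≤ ‖D ω‖} ⊆ {ω | ENNReal.ofReal a * V ≤ ballMGF (c • D ω)} := by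
    intro ω hω
    refine le_trans ?_ (le_ballMGF hε₀ hε₁ (c • D ω))
    rw [finrank_euclideanSpace_fin, norm_smul, Real.norm_of_nonneg hc, ha]
    have h1 : c * r ≤ c * ‖D ω‖ := mul_le_mul_of_nonneg_left hω hc
    have h2 : 0 ≤ 1 - ε := by linarith
    gcongr
  have hmarkov := mul_meas_ge_le_lintegral (μ := μ)
    (measurable_ballMGF.comp (hD.const_smul c)) (ENNReal.ofReal a * V)
  have hle : ENNReal.ofReal a * μ {ω | r ≤ ‖D ω‖} ≤
      ENNReal.ofReal (Real.exp (c ^ 2 * S / 2)) := by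
    rw [← ENNReal.mul_le_mul_iff_left hV0 hVtop]
    refine le_trans ?_ (hmarkov.trans h)
    rw [mul_right_comm]
    exact mul_le_mul_right (measure_mono (μ := μ) hsub) _
  rw [mul_comm, ← ENNReal.le_div_iff_mul_le (Or.inl (by simpa using ha0)) (Or.inl (by simp)),
    ← ENNReal.ofReal_div_of_pos ha0] at hle
  refine hle.trans (ENNReal.ofReal_le_ofReal (le_of_eq ?_))
  rw [ha, Real.exp_sub, ← inv_div ε 2, inv_pow]
  field_simp

theorem measure_norm_gt_le {D : Ω → Vec n} (hD : Measurable D) {S : ℝ} (hS : 0 ≤ S)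
    (h : ∀ c : ℝ, 0 ≤ c → ∫⁻ ω, ballMGF (c • D ω) ∂μ ≤
      ENNReal.ofReal (Real.exp (c ^ 2 * S / 2)) * volume (Metric.closedBall (0 : Vec n) 1))
    {ε : ℝ} (hε₀ : 0 < ε) (hε₁ : ε < 1) {δ : ℝ} (hδ₀ : 0 < δ) (hδ₁ : δ ≤ 1) :
    μ {ω | √(S * (eps1 ε * n + eps2 ε * Real.log (1 / δ))) < ‖D ω‖} ≤ ENNReal.ofReal δ := by
  have hε : 0 < 1 - ε := by linarith
  -- For S = 0 there is no finite optimal c; letting c → ∞ shows that D vanishes almost surely.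
  rcases hS.eq_or_lt with rfl | hS
  · have hnull : ∀ k : ℕ, μ {ω | (1 : ℝ) / (k + 1) ≤ ‖D ω‖} = 0 := fun k => by
      refine le_antisymm (ge_of_tendsto (x := Filter.atTop) (f := fun c : ℝ => ENNReal.ofReal
        ((2 / ε) ^ n * Real.exp (-((1 - ε) * (1 / ((k : ℝ) + 1))) * c))) ?_ ?_) bot_le
      · rw [← ENNReal.ofReal_zero, ← mul_zero ((2 / ε) ^ n)]
        refine ENNReal.tendsto_ofReal (Filter.Tendsto.const_mul _ ?_)
        refine Real.tendsto_exp_atBot.comp (Filter.tendsto_id.const_mul_atTop_of_neg ?_)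
        have : 0 < (1 - ε) * (1 / ((k : ℝ) + 1)) := by positivity
        linarith
      · filter_upwards [Filter.eventually_ge_atTop 0] with c hc
        refine (measure_norm_ge_le hD hc (h c hc) hε₀ hε₁ (1 / ((k : ℝ) + 1))).trans_eq ?_
        congr 3
        ring
    have hsub : {ω | √(0 * (eps1 ε * n + eps2 ε * Real.log (1 / δ))) < ‖D ω‖} ⊆
        ⋃ k : ℕ, {ω | (1 : ℝ) / (k + 1) ≤ ‖D ω‖} := by
      intro ω hω
      simp only [zero_mul, Real.sqrt_zero, Set.mem_ofPred_eq] at hω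
      obtain ⟨k, hk⟩ := exists_nat_one_div_lt hω
      exact Set.mem_iUnion.mpr ⟨k, hk.le⟩
    rw [measure_mono_null hsub (measure_iUnion_null hnull)]
    exact bot_le
  set K := eps1 ε * n + eps2 ε * Real.log (1 / δ) with hK
  have hlog₁ : 0 ≤ Real.log (1 / δ) := Real.log_nonneg (by rwa [le_div_iff₀ hδ₀, one_mul])
  have hone : 1 ≤ 1 + 2 / ε := by
    have : 0 < 2 / ε := by positivity
    linarith
  have hlog₂ : 0 ≤ Real.log (1 + 2 / ε) := Real.log_nonneg hone
  have hK0 : 0 ≤ K := by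
    rw [hK, eps1, eps2]
    positivity
  set r := √(S * K) with hr
  have hr2 : r ^ 2 = S * K := Real.sq_sqrt (by positivity)
  -- This value of c minimises c²S/2 - (1-ε)cr.
  have hc : 0 ≤ (1 - ε) * r / S := by positivity
  have hexp : ((1 - ε) * r / S) ^ 2 * S / 2 - (1 - ε) * ((1 - ε) * r / S * r) =
      -(n * Real.log (1 + 2 / ε)) + Real.log δ := by
    have h1 : ((1 - ε) * r / S) ^ 2 * S / 2 - (1 - ε) * ((1 - ε) * r / S * r) =
        -((1 - ε) ^ 2 * r ^ 2 / (2 * S)) := by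
      field_simp
      ring
    rw [h1, hr2, hK, eps1, eps2, one_div, Real.log_inv]
    field_simp
    ring
  refine (measure_mono fun ω (hω : r < ‖D ω‖) => hω.le).trans
    ((measure_norm_ge_le hD hc (h _ hc) hε₀ hε₁ r).trans (ENNReal.ofReal_le_ofReal ?_))
  rw [hexp, Real.exp_add, Real.exp_log hδ₀, Real.exp_neg, mul_comm (n : ℝ), Real.exp_mul,
    Real.exp_log (by linarith), Real.rpow_natCast, ← mul_assoc]
  refine mul_le_of_le_one_left hδ₀.le ?_
  -- What is left is (2/ε)ⁿ ≤ (1 + 2/ε)ⁿ.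
  rw [← div_eq_mul_inv, div_le_one (by positivity)]
  gcongr
  linarith

end Concentration

/-! ### Propagation along the dynamics -/

section Dynamics

variable {n p : ℕ}

theorem Psi_succ (L σ : ℕ → ℝ) (t : ℕ) :
    Psi L σ (t + 1) = L t ^ 2 * Psi L σ t + σ t ^ 2 := by
  unfold Psi
  rw [Finset.sum_range_succ, Finset.Ico_self, Finset.prod_empty, mul_one, Finset.mul_sum]
  congr 1
  refine Finset.sum_congr rfl fun k hk => ?_
  rw [Finset.prod_Ico_succ_top (Finset.mem_range.mp hk)]
  ring

theorem Psi_nonneg (L σ : ℕ → ℝ) (t : ℕ) : 0 ≤ Psi L σ t :=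
  Finset.sum_nonneg fun _ _ =>
    mul_nonneg (sq_nonneg _) (Finset.prod_nonneg fun _ _ => sq_nonneg _)

theorem LipschitzDynamics.continuous {f : Vec n → Vec p → ℕ → Vec n} {L : ℕ → ℝ}
    (hf : LipschitzDynamics f L) (v : Vec p) (t : ℕ) : Continuous fun x => f x v t :=
  (LipschitzWith.of_dist_le_mul (K := ⟨L t, (hf t).1⟩) fun x y => by
    rw [dist_eq_norm, dist_eq_norm]
    exact (hf t).2 x y v).continuous

/-- The trajectory of the noise-free system `x_{t+1} = f(x_t, u_t, t)`. -/
def nominal (f : Vec n → Vec p → ℕ → Vec n) (x₀ : Vec n) (u : ℕ → Vec p) : ℕ → Vec n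
  | 0 => x₀
  | t + 1 => f (nominal f x₀ u t) (u t) t

theorem nominal_mem_box {f : Vec n → Vec p → ℕ → Vec n}
    {F : Vec n × Vec n → Vec p × Vec p → ℕ → Vec n × Vec n} (hF : IsInclusionFunction f F)
    {xlo xhi : Vec n} {ulo uhi : Vec p} {xe : ℕ → Vec n × Vec n}
    (hxe : IsEmbeddingTrajectory F xlo xhi ulo uhi xe) {x₀ : Vec n} (hx₀ : x₀ ∈ box xlo xhi)
    {u : ℕ → Vec p} (hu : ∀ t, u t ∈ box ulo uhi) (t : ℕ) :
    nominal f x₀ u t ∈ box (xe t).1 (xe t).2 := by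
  induction t with
  | zero => rwa [hxe.1]
  | succ t ih =>
    rw [hxe.2 t]
    exact hF _ _ _ _ t _ ih _ (hu t)

variable {Ω : Type*} {f : Vec n → Vec p → ℕ → Vec n} {L : ℕ → ℝ} {x₀ : Vec n} {u : ℕ → Vec p}
  {w X : ℕ → Ω → Vec n}

/-- The state at time t depends only on the noises before t; this is what makes it independent of `w
t`. -/
theorem IsStochasticTrajectory.measurable_iSup_comap (hf : LipschitzDynamics f L)
    (hX : IsStochasticTrajectory f x₀ u w X) (t : ℕ) :
    Measurable[⨆ i ∈ Set.Iio t, MeasurableSpace.comap (w i) inferInstance] (X t) := by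
  induction t with
  | zero =>
    rw [show X 0 = fun _ => x₀ from funext hX.1]
    exact measurable_const
  | succ t ih =>
    rw [show X (t + 1) = fun ω => f (X t ω) (u t) t + w t ω from funext (hX.2 t)]
    refine Measurable.add ((hf.continuous (u t) t).measurable.comp (ih.mono ?_ le_rfl)) ?_
    · exact biSup_mono fun i (hi : i < t) => hi.trans t.lt_succ_self
    · exact (comap_measurable (w t)).mono
        (le_biSup (fun i => MeasurableSpace.comap (w i) inferInstance) t.lt_succ_self) le_rfl

variable [MeasurableSpace Ω] {μ : Measure Ω}

theorem IsStochasticTrajectory.measurable (hf : LipschitzDynamics f L)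
    (hX : IsStochasticTrajectory f x₀ u w X) (hw : ∀ t, Measurable (w t)) (t : ℕ) :
    Measurable (X t) :=
  (hX.measurable_iSup_comap hf t).mono (iSup₂_le fun i _ => (hw i).comap_le) le_rfl

theorem IsStochasticTrajectory.indepFun (hf : LipschitzDynamics f L)
    (hX : IsStochasticTrajectory f x₀ u w X) (hw : ∀ t, Measurable (w t))
    (hind : iIndepFun w μ) (t : ℕ) : IndepFun (X t) (w t) μ := by
  have h := indep_iSup_of_disjoint (fun i => (hw i).comap_le) hind
    (S := Set.Iio t) (T := {t}) (by simp)
  rw [IndepFun_iff_Indep]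
  refine indep_of_indep_of_le_left (indep_of_indep_of_le_right h ?_)
    (hX.measurable_iSup_comap hf t).comap_le
  exact le_biSup (fun i => MeasurableSpace.comap (w i) inferInstance) (Set.mem_singleton t)

theorem lintegral_ballMGF_sub_nominal_le [IsProbabilityMeasure μ] (hf : LipschitzDynamics f L)
    (hX : IsStochasticTrajectory f x₀ u w X) (hw : ∀ t, Measurable (w t))
    (hind : iIndepFun w μ) {σ : ℕ → ℝ} (hsub : ∀ t, IsSubGaussian (w t) (σ t ^ 2) μ)
    (t : ℕ) (c : ℝ) :
    ∫⁻ ω, ballMGF (c • (X t ω - nominal f x₀ u t)) ∂μ ≤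
      ENNReal.ofReal (Real.exp (c ^ 2 * Psi L σ t / 2)) *
        volume (Metric.closedBall (0 : Vec n) 1) := by
  induction t generalizing c with
  | zero => simp [hX.1, nominal, Psi, ballMGF_zero]
  | succ t ih =>
    set φ : Vec n → Vec n := fun x => f x (u t) t - nominal f x₀ u (t + 1) with hφ
    have hφm : Measurable φ := (hf.continuous (u t) t).measurable.sub_const _
    have hstep : ∀ ω, X (t + 1) ω - nominal f x₀ u (t + 1) = φ (X t ω) + w t ω := fun ω => by
      rw [hX.2 t ω, hφ, add_sub_right_comm]
    -- Monotonicity in the norm is what lets the Lipschitz bound pass through `ballMGF`.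
    have hcontr : ∀ ω, ballMGF (c • φ (X t ω)) ≤
        ballMGF ((c * L t) • (X t ω - nominal f x₀ u t)) := fun ω => by
      refine ballMGF_mono ?_
      rw [norm_smul, norm_smul, norm_mul, Real.norm_of_nonneg (hf t).1, mul_assoc]
      gcongr
      exact (hf t).2 _ _ _
    simp_rw [hstep]
    calc _ ≤ ENNReal.ofReal (Real.exp (c ^ 2 * σ t ^ 2 / 2)) *
          ∫⁻ ω, ballMGF (c • φ (X t ω)) ∂μ :=
          lintegral_ballMGF_add_le (sq_nonneg _) (hφm.comp (hX.measurable hf hw t)) (hw t)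
            ((hX.indepFun hf hw hind t).comp hφm measurable_id) (hsub t) c
      _ ≤ ENNReal.ofReal (Real.exp (c ^ 2 * σ t ^ 2 / 2)) *
          (ENNReal.ofReal (Real.exp ((c * L t) ^ 2 * Psi L σ t / 2)) *
            volume (Metric.closedBall (0 : Vec n) 1)) := by
          gcongr
          exact (lintegral_mono hcontr).trans (ih (c * L t))
      _ = _ := by
          rw [← mul_assoc, ← ENNReal.ofReal_mul (Real.exp_nonneg _), ← Real.exp_add, Psi_succ]
          congr 3
          ring

end Dynamics

end StochReach

theorem mainTheorem8 {n p : ℕ} {Ω : Type*} [MeasurableSpace Ω]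
    (μ : Measure Ω) [IsProbabilityMeasure μ]
    (f : StochReach.Vec n → StochReach.Vec p → ℕ → StochReach.Vec n)
    (L : ℕ → ℝ) (hf : StochReach.LipschitzDynamics f L)
    (σ : ℕ → ℝ) (hσ : ∀ t, 0 ≤ σ t)
    (w : ℕ → Ω → StochReach.Vec n) (hw_meas : ∀ t, Measurable (w t))
    (hw_indep : iIndepFun w μ)
    (hw_subG : ∀ t, StochReach.IsSubGaussian (w t) (σ t ^ 2) μ)
    (F : StochReach.Vec n × StochReach.Vec n → StochReach.Vec p × StochReach.Vec p → ℕ →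
      StochReach.Vec n × StochReach.Vec n)
    (hF : StochReach.IsInclusionFunction f F)
    (xlo xhi : StochReach.Vec n) (ulo uhi : StochReach.Vec p)
    (xe : ℕ → StochReach.Vec n × StochReach.Vec n)
    (hxe : StochReach.IsEmbeddingTrajectory F xlo xhi ulo uhi xe)
    (x₀ : StochReach.Vec n) (hx₀ : x₀ ∈ StochReach.box xlo xhi)
    (u : ℕ → StochReach.Vec p) (hu : ∀ t, u t ∈ StochReach.box ulo uhi)
    (X : ℕ → Ω → StochReach.Vec n)
    (hX : StochReach.IsStochasticTrajectory f x₀ u w X)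
    (t : ℕ) (δ : ℝ) (hδ₀ : 0 < δ) (hδ₁ : δ ≤ 1) (ε : ℝ) (hε₀ : 0 < ε) (hε₁ : ε < 1) :
    1 - δ ≤ μ.real {ω | X t ω ∈ StochReach.box (xe t).1 (xe t).2 +
      Metric.closedBall (0 : StochReach.Vec n) (StochReach.radius n L σ ε δ t)} := by

  have hXm := hX.measurable hf hw_meas t
  have hDm : Measurable fun ω => X t ω - StochReach.nominal f x₀ u t := hXm.sub_const _
  have htail := StochReach.measure_norm_gt_le hDm (StochReach.Psi_nonneg L σ t)
    (fun c _ => StochReach.lintegral_ballMGF_sub_nominal_le hf hX hw_meas hw_indep hw_subG t c)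
    hε₀ hε₁ hδ₀ hδ₁
  set B := {ω | StochReach.radius n L σ ε δ t < ‖X t ω - StochReach.nominal f x₀ u t‖} with hB
  -- Measurability is needed only for the deviation event, whose complement lies inside the target
  -- event.
  have hBm : MeasurableSet B := measurableSet_lt measurable_const hDm.norm
  have hreal : μ.real B ≤ δ := ENNReal.toReal_le_of_le_ofReal hδ₀.le htail
  have hcompl : 1 - δ ≤ μ.real Bᶜ := by
    rw [probReal_compl_eq_one_sub hBm]
    linarith
  refine hcompl.trans (measureReal_mono fun ω hω => ?_)
  refine ⟨_, StochReach.nominal_mem_box hF hxe hx₀ hu t, X t ω - StochReach.nominal f x₀ u t,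
    ?_, add_sub_cancel _ _⟩
  rw [mem_closedBall_zero_iff]
  exact not_lt.mp hω
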